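/- Let $\Sigma$ be a compact smooth surface, possibly with boundary, with a symplectic (area) form $\omega$. A Hamiltonian isotopy is a smooth family of diffeomorphisms $\varphi^t$ of $\Sigma$ with $\varphi^0=\mathrm{id}$ and $\omega(\partial_t\varphi^t,\cdot)=dH_t$ for a smooth function $H:\mathbb R\times\Sigma\to\mathbb R$ (so the flow is tangent to $\partial\Sigma$, but it may be nonzero there); $\mathrm{Ham}(\Sigma)$ is the set of all time-$1$ maps of such isotopies, and $g$ is *autonomous* if it is the time-$1$ map of an isotopy with $H$ independent of $t$ (an autonomous flow). A *loop of fixed points* of an autonomous $g$ is a non-constant periodic trajectory $c$ of an autonomous flow with time-$1$ map $g$, whose minimal period $T$ satisfies $1/T\in\mathbb N$. For $A\subset\Sigma$, a family $\mathcal M\subset\mathrm{Ham}(\Sigma)$ has the *fixed loop property $\mathcal F_A$* if every autonomous element of $\mathcal M$ has a loop of fixed points that intersects $A$. Let $L\subset\Sigma$ be an oriented smooth embedded curve that is either closed and contained in the interior of $\Sigma$, or a simple arc joining two points of $\partial\Sigma$ and meeting $\partial\Sigma$ only at its endpoints. Let $N\subset\Sigma$ be a set containing $\partial\Sigma$ (for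 instance a neighbourhood of $\partial\Sigma$; $N=\emptyset$ is allowed if $\partial\Sigma=\emptyset$). Suppose that $\mathcal M\subset\mathrm{Ham}(\Sigma)$ has the property $\mathcal F_{L\setminus N}$: every autonomous element of $\mathcal M$ has a loop of fixed points that meets $L$ outside $N$. Let $g\in\mathcal M$, and orient $g(L)$ as the image of $L$ under $g$. Suppose that 1. $L$ and $g(L)$ intersect transversely at every point of $(L\cap g(L))\setminus N$; 2. every point of $(L\cap g(L))\setminus N$ has an open neighbourhood $U$ and a diffeomorphism $\psi:U\to\mathbb R^2$ that maps $L\cap U$ onto the $x$-axis, oriented in the direction of increasing $x$, and maps $g(L)\cap U$ onto one of the two "snakes" $\{y=x^3-x\}$, $\{y=-(x^3-x)\}$, oriented in the direction of decreasing $x$. (Thus inside $U$ the curve $g(L)$ crosses $L$ exactly three times, in the order opposite to the order along $L$.) Then $g$ is not autonomous. -/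

import Mathlib

open Set
open scoped Manifold ContDiff

noncomputable section

namespace CurveObstruction

/-- The plane, which is also the model of every tangent space of a surface. -/
abbrev Plane : Type := EuclideanSpace ℝ (Fin 2)

section Surface

variable (S : Type*) [TopologicalSpace S] [ChartedSpace (EuclideanHalfSpace 2) S]
  [IsManifold (𝓡∂ 2) ∞ S]

/-- A symplectic form on a smooth surface (possibly with boundary): a smooth, alternating,
nondegenerate 2-form. It is automatically closed, since the surface has dimension 2, and its
existence makes the surface orientable (it orients it). -/
structure SymplecticForm where
  /-- the value of the form at a point -/
  form : ∀ x : S, TangentSpace (𝓡∂ 2) x →L[ℝ] TangentSpace (𝓡∂ 2) x →L[ℝ] ℝ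
  alternating : ∀ x v, form x v v = 0
  nondegenerate : ∀ x v, (∀ w, form x v w = 0) → v = 0
  contMDiff : ContMDiff (𝓡∂ 2) ((𝓡∂ 2).prod 𝓘(ℝ, Plane →L[ℝ] Plane →L[ℝ] ℝ)) ∞
    (fun x ↦ Bundle.TotalSpace.mk' (Plane →L[ℝ] Plane →L[ℝ] ℝ) x (form x) :
      S → Bundle.TotalSpace (Plane →L[ℝ] Plane →L[ℝ] ℝ)
        (fun x : S ↦ TangentSpace (𝓡∂ 2) x →L[ℝ] TangentSpace (𝓡∂ 2) x →L[ℝ] ℝ))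

/-- Smooth diffeomorphisms of the surface. -/
abbrev Diffeo : Type _ := Diffeomorph (𝓡∂ 2) (𝓡∂ 2) S S ∞

variable {S}

/-- `φ` is the Hamiltonian isotopy (defined for all times) generated by the time-dependent smooth
Hamiltonian function `H`: `φ 0 = id` and `Ω (∂φ/∂t, ·) = d(H t)` at `φ t x`.
As every `φ t` is a diffeomorphism of a surface with boundary, the generating vector field is
automatically tangent to the boundary; it may be nonzero there. -/
structure IsHamiltonianIsotopy (Ω : SymplecticForm S) (H : ℝ → S → ℝ) (φ : ℝ → Diffeo S) :
    Prop where
  smooth_hamiltonian :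
    ContMDiff (𝓘(ℝ, ℝ).prod (𝓡∂ 2)) 𝓘(ℝ, ℝ) ∞ (fun p : ℝ × S ↦ H p.1 p.2)
  smooth_isotopy :
    ContMDiff (𝓘(ℝ, ℝ).prod (𝓡∂ 2)) (𝓡∂ 2) ∞ (fun p : ℝ × S ↦ φ p.1 p.2)
  zero : ∀ x, φ 0 x = x
  hamilton : ∀ (t : ℝ) (x : S) (v : TangentSpace (𝓡∂ 2) (φ t x)),
    Ω.form (φ t x) (mfderiv 𝓘(ℝ, ℝ) (𝓡∂ 2) (fun s : ℝ ↦ φ s x) t (1 : ℝ)) v =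
      mfderiv (𝓡∂ 2) 𝓘(ℝ, ℝ) (H t) (φ t x) v

/-- `Ham(S)`: the time-1 maps of Hamiltonian isotopies. -/
def Ham (Ω : SymplecticForm S) : Set (Diffeo S) :=
  {g | ∃ (H : ℝ → S → ℝ) (φ : ℝ → Diffeo S), IsHamiltonianIsotopy Ω H φ ∧ φ 1 = g}

/-- `φ` is the flow of a time-independent Hamiltonian function. -/
def IsAutonomousFlow (Ω : SymplecticForm S) (φ : ℝ → Diffeo S) : Prop :=
  ∃ H : S → ℝ, IsHamiltonianIsotopy Ω (fun _ ↦ H) φ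

/-- `g` is autonomous: the time-1 map of an autonomous Hamiltonian flow. -/
def IsAutonomous (Ω : SymplecticForm S) (g : Diffeo S) : Prop :=
  ∃ φ : ℝ → Diffeo S, IsAutonomousFlow Ω φ ∧ φ 1 = g

/-- `c` is a loop of fixed points of the time-1 map of the flow `φ`: a nonconstant periodic
trajectory whose (minimal) period `T` has rotation number `1 / T` a natural number. -/
def IsLoopOfFixedPoints (φ : ℝ → Diffeo S) (c : Set S) : Prop :=
  ∃ (x : S) (T : ℝ), 0 < T ∧ φ T x = x ∧ (∀ s, 0 < s → s < T → φ s x ≠ x) ∧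
    c = range (fun t ↦ φ t x) ∧ ∃ n : ℕ, 1 / T = n

/-- The fixed loop property of the family `M` detectable by the set `A`: every autonomous `g ∈ M`
has a loop of fixed points (of a flow that generates `g`) which intersects `A`. -/
def HasFixedLoopProperty (Ω : SymplecticForm S) (M : Set (Diffeo S)) (A : Set S) : Prop :=
  ∀ g ∈ M, IsAutonomous Ω g →
    ∃ φ : ℝ → Diffeo S, IsAutonomousFlow Ω φ ∧ φ 1 = g ∧
      ∃ c : Set S, IsLoopOfFixedPoints φ c ∧ (c ∩ A).Nonempty

/-- The velocity of a curve parametrized by `[0, 1]` (one-sided at the ends), as a vector of the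
tangent space at `γ t`. -/
def velocity (γ : ℝ → S) (t : ℝ) : Plane :=
  (mfderivWithin 𝓘(ℝ, ℝ) (𝓡∂ 2) γ (Icc 0 1) t (1 : ℝ) : TangentSpace (𝓡∂ 2) (γ t))

/-- The curve traced by a parametrization on `[0, 1]`. -/
def curveTrace (γ : ℝ → S) : Set S := γ '' Icc 0 1

/-- A regularly parametrized simple closed smooth curve which avoids the boundary. -/
structure IsSimpleClosedCurve (γ : ℝ → S) : Prop where
  smooth : ContMDiff 𝓘(ℝ, ℝ) (𝓡∂ 2) ∞ γ
  periodic : Function.Periodic γ 1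
  injOn : InjOn γ (Ico 0 1)
  regular : ∀ t ∈ Icc (0 : ℝ) 1, velocity γ t ≠ 0
  interior : ∀ t, γ t ∉ (𝓡∂ 2).boundary S

/-- A regularly parametrized simple smooth arc which touches the boundary exactly at its two
endpoints. -/
structure IsSimpleArc (γ : ℝ → S) : Prop where
  smooth : ContMDiffOn 𝓘(ℝ, ℝ) (𝓡∂ 2) ∞ γ (Icc 0 1)
  injOn : InjOn γ (Icc 0 1)
  regular : ∀ t ∈ Icc (0 : ℝ) 1, velocity γ t ≠ 0
  boundary_iff : ∀ t ∈ Icc (0 : ℝ) 1, γ t ∈ (𝓡∂ 2).boundary S ↔ t = 0 ∨ t = 1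

/-- The curves `L` that are considered, with a parametrization, which also orients them. -/
def IsAdmissibleCurve (γ : ℝ → S) : Prop := IsSimpleClosedCurve γ ∨ IsSimpleArc γ

/-- The curves parametrized by `γ` and `δ` are transverse at `p`. -/
def TransverseAt (γ δ : ℝ → S) (p : S) : Prop :=
  ∀ s ∈ Icc (0 : ℝ) 1, ∀ t ∈ Icc (0 : ℝ) 1, γ s = p → δ t = p →
    LinearIndependent ℝ ![velocity γ s, velocity δ t]

/-- In the open set `ψ.source` the pair of oriented curves `γ`, `δ` is diffeomorphic, through `ψ`,
to one of the two snake configurations in the plane: `γ` becomes the horizontal axis, oriented to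
the right, and `δ` becomes the curve `y = ε (x ^ 3 - x)`, oriented to the left. So `δ` crosses `γ`
at the three points `-1, 0, 1` of the axis, in the order opposite to that along `γ`. The two
configurations `ε = 1` (where `δ` passes from the left side of `γ` to its right side) and
`ε = -1` (from right to left) are mirror images of each other. -/
structure IsSnake (γ δ : ℝ → S)
    (ψ : PartialDiffeomorph (𝓡∂ 2) 𝓘(ℝ, Plane) S Plane ∞) : Prop where
  target_eq : ψ.target = univ
  image_left : ψ '' (curveTrace γ ∩ ψ.source) = {q : Plane | q 1 = 0}
  image_right : ∃ ε : ℝ, (ε = 1 ∨ ε = -1) ∧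
    ψ '' (curveTrace δ ∩ ψ.source) = {q : Plane | q 1 = ε * (q 0 ^ 3 - q 0)}
  orient_left : ∀ t ∈ Icc (0 : ℝ) 1, γ t ∈ ψ.source →
    0 < derivWithin (fun s ↦ ψ (γ s) 0) (Icc 0 1) t
  orient_right : ∀ t ∈ Icc (0 : ℝ) 1, δ t ∈ ψ.source →
    derivWithin (fun s ↦ ψ (δ s) 0) (Icc 0 1) t < 0

end Surface

end CurveObstruction

end

open CurveObstruction

open scoped Topology

namespace CurveObstruction

/-! Suppose `g` is the time-1 map of an autonomous flow with Hamiltonian `H` and velocity field `X`.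
Every point of a loop of fixed points is fixed by `g`, because the period is `1/n`. So a point where
the loop meets `L` outside `N` also lies on `g(L)`, and it is one of the three crossings of a snake.

At a fixed crossing let `D` be the differential of `g` and `v` the tangent of `L`. Conservation of
`H` puts `D v - v` in the kernel of `dH`, which is the line spanned by `X`
(`exists_mfderiv_sub_eq_smul`). Since `v` points right and `D v` points left along the snake, `X`
points into the sectors between the two curves that contain the bigons
(`exists_hasDerivAt_between`).

A point fixed by `g` lies on `L` exactly when it lies on `g(L)`. Hence the loop can cross the
boundary of a bigon only at a corner, and a closed loop that enters at one corner must pass through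
the other (`exists_apply_eq_of_bigon`). The loop therefore runs through all three crossings, and `g`
fixes each of them. Then `g` preserves their order along `L`, linear for an arc and cyclic for a
closed curve, whereas the snake reverses it (`IsSnake.exists_apply_ne`). -/

theorem isInteriorPoint_apply_iff {S : Type*} [TopologicalSpace S]
    [ChartedSpace (EuclideanHalfSpace 2) S] (g : Diffeo S) (x : S) :
    (𝓡∂ 2).IsInteriorPoint (g x) ↔ (𝓡∂ 2).IsInteriorPoint x :=
  ((g.isLocalDiffeomorph x).isInteriorPoint_iff (by simp)).symm

/-! ### Autonomous Hamiltonian flows: group law, energy, differential at a fixed point -/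

section Flow

variable {S : Type*} [TopologicalSpace S] [ChartedSpace (EuclideanHalfSpace 2) S]
  [IsManifold (𝓡∂ 2) ∞ S]

/-- The initial velocity field of an isotopy. -/
noncomputable def initialVelocity (φ : ℝ → Diffeo S) (x : S) : TangentSpace (𝓡∂ 2) x :=
  (mfderiv 𝓘(ℝ, ℝ) (𝓡∂ 2) (fun s : ℝ ↦ φ s x) 0 (1 : ℝ) : Plane)

variable {Ω : SymplecticForm S} {H : S → ℝ} {φ : ℝ → Diffeo S}

theorem SymplecticForm.eq_of_form_eq (Ω : SymplecticForm S) {x : S}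
    {v w : TangentSpace (𝓡∂ 2) x} (h : ∀ u, Ω.form x v u = Ω.form x w u) : v = w := by
  refine sub_eq_zero.mp (Ω.nondegenerate x _ fun u ↦ ?_)
  rw [map_sub, sub_apply, h, sub_self]

/-- On a surface the `Ω`-orthogonal complement of a nonzero vector is the line it spans. -/
theorem SymplecticForm.exists_eq_smul (Ω : SymplecticForm S) {x : S}
    {v w : TangentSpace (𝓡∂ 2) x} (hv : v ≠ 0) (h : Ω.form x v w = 0) :
    ∃ k : ℝ, w = k • v := by
  by_contra! hk
  have hli : LinearIndependent ℝ ![v, w] := by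
    rw [LinearIndependent.pair_iff' hv]
    exact fun a ha ↦ hk a ha.symm
  have : FiniteDimensional ℝ (TangentSpace (𝓡∂ 2) x) := inferInstanceAs (FiniteDimensional ℝ Plane)
  have hspan : Submodule.span ℝ (range ![v, w]) = ⊤ :=
    hli.span_eq_top_of_card_eq_finrank' (by
      change Fintype.card (Fin 2) = Module.finrank ℝ Plane
      simp)
  refine hv (Ω.nondegenerate x v fun u ↦ ?_)
  have hu : u ∈ Submodule.span ℝ (range ![v, w]) := hspan ▸ Submodule.mem_top
  refine Submodule.span_induction (p := fun u _ ↦ Ω.form x v u = 0) ?_ (map_zero _) ?_ ?_ hu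
  · rintro _ ⟨i, rfl⟩
    fin_cases i
    · exact Ω.alternating x v
    · exact h
  · intro a b _ _ ha hb
    rw [map_add, ha, hb, add_zero]
  · intro c a _ ha
    rw [map_smul, ha, smul_zero]

theorem IsHamiltonianIsotopy.mdifferentiableAt_trajectory {H : ℝ → S → ℝ}
    (h : IsHamiltonianIsotopy Ω H φ) (x : S) (t : ℝ) :
    MDifferentiableAt 𝓘(ℝ, ℝ) (𝓡∂ 2) (fun s : ℝ ↦ φ s x) t := by
  have : ContMDiff 𝓘(ℝ, ℝ) (𝓡∂ 2) ∞ (fun s : ℝ ↦ φ s x) :=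
    h.smooth_isotopy.comp (contMDiff_id.prodMk contMDiff_const)
  exact this.mdifferentiableAt (by simp)

theorem IsHamiltonianIsotopy.continuous_trajectory {H : ℝ → S → ℝ}
    (h : IsHamiltonianIsotopy Ω H φ) (x : S) : Continuous (fun s : ℝ ↦ φ s x) :=
  continuous_iff_continuousAt.mpr fun t ↦ (h.mdifferentiableAt_trajectory x t).continuousAt

theorem IsHamiltonianIsotopy.form_initialVelocity
    (h : IsHamiltonianIsotopy Ω (fun _ ↦ H) φ) (x : S) (v : TangentSpace (𝓡∂ 2) x) :
    Ω.form x (initialVelocity φ x) v = mfderiv (𝓡∂ 2) 𝓘(ℝ, ℝ) H x v := by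
  -- The equality `φ 0 x = x` is only propositional, so the base point is generalized before the
  -- identity is transported to the tangent space at `x`.
  have key : ∀ y : S, y = x → ∀ w : Plane,
      Ω.form y (mfderiv 𝓘(ℝ, ℝ) (𝓡∂ 2) (fun s : ℝ ↦ φ s x) 0 (1 : ℝ) : Plane) w =
        mfderiv (𝓡∂ 2) 𝓘(ℝ, ℝ) H y w →
      Ω.form x (mfderiv 𝓘(ℝ, ℝ) (𝓡∂ 2) (fun s : ℝ ↦ φ s x) 0 (1 : ℝ) : Plane) w =
        mfderiv (𝓡∂ 2) 𝓘(ℝ, ℝ) H x w := by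
    rintro y rfl w hw
    exact hw
  exact key (φ 0 x) (h.zero x) v (h.hamilton 0 x v)

/-- No group law is needed: the velocity at time `t` and the initial velocity at `φ t x` are both
dual to `dH` at the same point, so nondegeneracy identifies them. -/
theorem IsHamiltonianIsotopy.isMIntegralCurve
    (h : IsHamiltonianIsotopy Ω (fun _ ↦ H) φ) (x : S) :
    IsMIntegralCurve (I := 𝓡∂ 2) (fun t ↦ φ t x) (initialVelocity φ) := by
  intro t
  refine (h.mdifferentiableAt_trajectory x t).hasMFDerivAt.congr_mfderiv ?_
  have : (mfderiv 𝓘(ℝ, ℝ) (𝓡∂ 2) (fun s : ℝ ↦ φ s x) t (1 : ℝ)) =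
      initialVelocity φ (φ t x) :=
    Ω.eq_of_form_eq fun u ↦ by rw [h.hamilton, h.form_initialVelocity]
  refine ContinuousLinearMap.ext_ring (R₁ := ℝ) (M₁ := Plane) (this.trans ?_)
  exact (one_smul ℝ (initialVelocity φ (φ t x) : Plane)).symm

/-- The field is the tangent map of `(t, x) ↦ φ t x` evaluated on the smooth section `∂/∂t` along `t
= 0`. Its regularity is what uniqueness of integral curves requires. -/
theorem IsHamiltonianIsotopy.contMDiff_initialVelocity {H : ℝ → S → ℝ}
    (h : IsHamiltonianIsotopy Ω H φ) :
    ContMDiff (𝓡∂ 2) (𝓡∂ 2).tangent 1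
      (fun x ↦ (⟨x, initialVelocity φ x⟩ : TangentBundle (𝓡∂ 2) S)) := by
  let F : ℝ × S → S := fun p ↦ φ p.1 p.2
  have hF : ContMDiff (𝓘(ℝ, ℝ).prod (𝓡∂ 2)) (𝓡∂ 2) ∞ F := h.smooth_isotopy
  have hT : ContMDiff (𝓘(ℝ, ℝ).prod (𝓡∂ 2)).tangent (𝓡∂ 2).tangent 1
      (tangentMap (𝓘(ℝ, ℝ).prod (𝓡∂ 2)) (𝓡∂ 2) F) :=
    hF.contMDiff_tangentMap (m := 1) (by norm_cast)
  have hsec : ContMDiff (𝓡∂ 2) (𝓘(ℝ, ℝ).prod (𝓡∂ 2)).tangent 1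
      (fun x : S ↦ (equivTangentBundleProd 𝓘(ℝ, ℝ) ℝ (𝓡∂ 2) S).symm
        ((⟨0, (1 : ℝ)⟩ : TangentBundle 𝓘(ℝ, ℝ) ℝ), (⟨x, 0⟩ : TangentBundle (𝓡∂ 2) S))) := by
    refine contMDiff_equivTangentBundleProd_symm.comp (contMDiff_const.prodMk ?_)
    exact Bundle.contMDiff_zeroSection ℝ (TangentSpace (𝓡∂ 2) : S → Type _)
  have := hT.comp hsec
  refine this.congr fun x ↦ ?_
  have h1 : HasMFDerivAt 𝓘(ℝ, ℝ) (𝓘(ℝ, ℝ).prod (𝓡∂ 2)) (fun s : ℝ ↦ (s, x)) 0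
      ((ContinuousLinearMap.id ℝ ℝ).prod (0 : ℝ →L[ℝ] Plane)) :=
    (hasMFDerivAt_id 0).prodMk (hasMFDerivAt_const x 0)
  have h2 := ((hF.mdifferentiableAt (by simp) (x := ((0 : ℝ), x))).hasMFDerivAt.comp 0 h1).mfderiv
  have h3 : (mfderiv 𝓘(ℝ, ℝ) (𝓡∂ 2) (fun s : ℝ ↦ φ s x) 0 (1 : ℝ) : Plane) =
      mfderiv (𝓘(ℝ, ℝ).prod (𝓡∂ 2)) (𝓡∂ 2) F ((0 : ℝ), x) ((1 : ℝ), (0 : Plane)) := by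
    change (mfderiv 𝓘(ℝ, ℝ) (𝓡∂ 2) (F ∘ fun s : ℝ ↦ (s, x)) 0 (1 : ℝ) : Plane) = _
    rw [h2]
    rfl
  have h0 : F ((0 : ℝ), x) = x := h.zero x
  change (⟨x, initialVelocity φ x⟩ : TangentBundle (𝓡∂ 2) S) =
    ⟨F ((0 : ℝ), x), mfderiv (𝓘(ℝ, ℝ).prod (𝓡∂ 2)) (𝓡∂ 2) F ((0 : ℝ), x) ((1 : ℝ), (0 : Plane))⟩
  have key : ∀ y : S, y = x → ∀ w : Plane, initialVelocity φ x = w →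
      (⟨x, initialVelocity φ x⟩ : TangentBundle (𝓡∂ 2) S) = ⟨y, w⟩ := by
    rintro y rfl w rfl
    rfl
  exact key _ h0 _ h3

/-- Uniqueness of integral curves through interior points; diffeomorphisms keep both trajectories in
the interior. -/
theorem IsHamiltonianIsotopy.apply_apply [T2Space S]
    (h : IsHamiltonianIsotopy Ω (fun _ ↦ H) φ) {x : S} (hx : (𝓡∂ 2).IsInteriorPoint x)
    (s t : ℝ) : φ s (φ t x) = φ (s + t) x := by
  have := isMIntegralCurve_eq_of_contMDiff (t₀ := 0) (I := 𝓡∂ 2) (v := initialVelocity φ)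
    (fun s ↦ (isInteriorPoint_apply_iff (φ s) (φ t x)).mpr
      ((isInteriorPoint_apply_iff (φ t) x).mpr hx))
    h.contMDiff_initialVelocity (h.isMIntegralCurve (φ t x))
    ((h.isMIntegralCurve x).comp_add t) (by simp [h.zero])
  exact congrFun this s

theorem IsHamiltonianIsotopy.apply_eq_of_initialVelocity_eq_zero [T2Space S]
    (h : IsHamiltonianIsotopy Ω (fun _ ↦ H) φ) {x : S} (hx : (𝓡∂ 2).IsInteriorPoint x)
    (h0 : initialVelocity φ x = 0) (t : ℝ) : φ t x = x := by
  have := isMIntegralCurve_eq_of_contMDiff (t₀ := 0) (I := 𝓡∂ 2) (v := initialVelocity φ)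
    (fun s ↦ (isInteriorPoint_apply_iff (φ s) x).mpr hx)
    h.contMDiff_initialVelocity (h.isMIntegralCurve x) (isMIntegralCurve_const h0) (h.zero x)
  exact congrFun this t

/-- Conservation of energy. -/
theorem IsHamiltonianIsotopy.hamiltonian_apply
    (h : IsHamiltonianIsotopy Ω (fun _ ↦ H) φ) (t : ℝ) (x : S) : H (φ t x) = H x := by
  have hH : MDifferentiable (𝓡∂ 2) 𝓘(ℝ, ℝ) H :=
    (h.smooth_hamiltonian.comp (contMDiff_const (c := (0 : ℝ)).prodMk contMDiff_id)).mdifferentiable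
      (by simp)
  have hd : ∀ s, HasDerivAt (fun s ↦ H (φ s x)) 0 s := by
    intro s
    have h1 := (hH (φ s x)).hasMFDerivAt.comp s (h.mdifferentiableAt_trajectory x s).hasMFDerivAt
    have h2 : HasFDerivAt (fun s ↦ H (φ s x)) (_ : ℝ →L[ℝ] ℝ) s :=
      hasMFDerivAt_iff_hasFDerivAt.mp h1
    refine h2.hasDerivAt.congr_deriv ?_
    exact (h.hamilton s x _).symm.trans (Ω.alternating _ _)
  have := is_const_of_deriv_eq_zero (fun s ↦ (hd s).differentiableAt) (fun s ↦ (hd s).deriv) t 0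
  simpa [h.zero] using this

/-- At a fixed point of an autonomous Hamiltonian map, the differential moves every tangent vector
in the direction of the flow. -/
theorem IsHamiltonianIsotopy.exists_mfderiv_sub_eq_smul
    (h : IsHamiltonianIsotopy Ω (fun _ ↦ H) φ) {t : ℝ} {x : S} (hx : φ t x = x)
    (h0 : initialVelocity φ x ≠ 0) {D : Plane →L[ℝ] Plane}
    (hD : HasMFDerivAt (𝓡∂ 2) (𝓡∂ 2) (φ t) x D) (v : Plane) :
    ∃ k : ℝ, D v - v = k • (initialVelocity φ x : Plane) := by
  have hH : MDifferentiable (𝓡∂ 2) 𝓘(ℝ, ℝ) H :=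
    (h.smooth_hamiltonian.comp (contMDiff_const (c := (0 : ℝ)).prodMk contMDiff_id)).mdifferentiable
      (by simp)
  obtain ⟨A, hA⟩ : ∃ A : Plane →L[ℝ] ℝ, HasMFDerivAt (𝓡∂ 2) 𝓘(ℝ, ℝ) H x A :=
    ⟨_, (hH x).hasMFDerivAt⟩
  have hA' : HasMFDerivAt (𝓡∂ 2) 𝓘(ℝ, ℝ) H (φ t x) A := by rwa [hx]
  have hc : HasMFDerivAt (𝓡∂ 2) 𝓘(ℝ, ℝ) (H ∘ φ t) x (A.comp D) := hA'.comp x hD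
  have heq : H ∘ φ t = H := funext fun y ↦ h.hamiltonian_apply t y
  rw [heq] at hc
  have hAD : A.comp D = A := hasMFDerivAt_unique hc hA
  refine Ω.exists_eq_smul (x := x) h0 ?_
  refine (h.form_initialVelocity x _).trans ?_
  rw [hA.mfderiv]
  change A (D v - v) = 0
  rw [map_sub, sub_eq_zero]
  exact congrArg (fun B : Plane →L[ℝ] ℝ ↦ B v) hAD

end Flow

/-! ### Trapping a closed trajectory in a bigon -/

section Bigon

variable {S : Type*} [TopologicalSpace S] [ChartedSpace (EuclideanHalfSpace 2) S]

theorem eventually_mul_pos_of_hasDerivAt {u : ℝ → ℝ} {a : ℝ} (hu : HasDerivAt u a 0)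
    (h0 : u 0 = 0) (ha : a ≠ 0) : ∀ᶠ t in 𝓝[≠] (0 : ℝ), 0 < u t * (a * t) := by
  have h1 := (hasDerivAt_iff_tendsto_slope.mp hu).mul_const a
  have h2 := h1.eventually (lt_mem_nhds (mul_self_pos.mpr ha))
  filter_upwards [h2, self_mem_nhdsWithin] with t ht ht0
  have ht0 : t ≠ 0 := ht0
  have : u t * (a * t) = (slope u 0 t * a) * t ^ 2 := by
    rw [slope_def_field, h0]
    field_simp
    ring
  rw [this]
  positivity

/-- A curve which leaves a crossing of the horizontal axis with the curve `y = ε (x ^ 3 - x)` in a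
direction between them stays between them for a short time, both forwards and backwards. -/
theorem eventually_between {f : ℝ → Plane} {Z : Plane} {x ε : ℝ} (hf : HasDerivAt f Z 0)
    (hx : f 0 0 = x) (hy : f 0 1 = 0) (hx3 : x ^ 3 = x) (hZ0 : Z 0 ≠ 0)
    (hZ : Z 1 * (Z 1 - ε * (3 * x ^ 2 - 1) * Z 0) < 0) :
    ∀ᶠ t in 𝓝[≠] (0 : ℝ), 0 < (f t 0 - x) * (Z 0 * t) ∧
      f t 1 * (f t 1 - ε * (f t 0 ^ 3 - f t 0)) < 0 := by
  have hc : ∀ i, HasDerivAt (fun t ↦ f t i) (Z i) 0 := fun i ↦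
    (EuclideanSpace.proj (𝕜 := ℝ) i).hasFDerivAt.comp_hasDerivAt 0 hf
  have hw : HasDerivAt (fun t ↦ f t 1 - ε * (f t 0 ^ 3 - f t 0))
      (Z 1 - ε * (3 * x ^ 2 - 1) * Z 0) 0 := by
    refine ((hc 1).sub ((((hc 0).pow 3).sub (hc 0)).const_mul ε)).congr_deriv ?_
    rw [hx]
    push_cast
    ring
  have h1 := eventually_mul_pos_of_hasDerivAt ((hc 0).sub_const x) (by simp [hx]) hZ0
  have h2 := eventually_mul_pos_of_hasDerivAt (hc 1) hy (left_ne_zero_of_mul hZ.ne)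
  have h3 := eventually_mul_pos_of_hasDerivAt hw (by rw [hy, hx, hx3]; simp)
    (right_ne_zero_of_mul hZ.ne)
  filter_upwards [h1, h2, h3] with t h1 h2 h3
  refine ⟨h1, ?_⟩
  have h4 := mul_pos h2 h3
  have h5 : f t 1 * (Z 1 * t) * ((f t 1 - ε * (f t 0 ^ 3 - f t 0)) *
      ((Z 1 - ε * (3 * x ^ 2 - 1) * Z 0) * t)) =
      (f t 1 * (f t 1 - ε * (f t 0 ^ 3 - f t 0))) *
        ((Z 1 * (Z 1 - ε * (3 * x ^ 2 - 1) * Z 0)) * t ^ 2) := by ring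
  rw [h5] at h4
  refine neg_of_mul_pos_left h4 ?_
  exact mul_nonpos_of_nonpos_of_nonneg hZ.le (sq_nonneg t)

theorem isCompact_bigon {a b ε : ℝ} (ha : -1 ≤ a) (hb : b ≤ 1) (hε : ε ^ 2 = 1) :
    IsCompact {q : Plane | a ≤ q 0 ∧ q 0 ≤ b ∧ q 1 * (q 1 - ε * (q 0 ^ 3 - q 0)) ≤ 0} := by
  have c : ∀ i, Continuous (fun q : Plane ↦ q i) := fun i ↦ by fun_prop
  refine Metric.isCompact_of_isClosed_isBounded ?_ ?_
  · exact (isClosed_le continuous_const (c 0)).inter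
      ((isClosed_le (c 0) continuous_const).inter
        (isClosed_le ((c 1).mul ((c 1).sub (continuous_const.mul (((c 0).pow 3).sub (c 0)))))
          continuous_const))
  · refine (Metric.isBounded_closedBall (x := (0 : Plane)) (r := 2)).subset ?_
    rintro q ⟨h1, h2, h3⟩
    rw [mem_closedBall_zero_iff, EuclideanSpace.norm_eq, Real.sqrt_le_left (by norm_num)]
    simp only [Fin.sum_univ_two, Real.norm_eq_abs, sq_abs]
    have hx : q 0 ^ 2 ≤ 1 := by nlinarith
    have hc : (ε * (q 0 ^ 3 - q 0)) ^ 2 ≤ 1 := by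
      have : (ε * (q 0 ^ 3 - q 0)) ^ 2 = ε ^ 2 * (q 0 ^ 2 * (1 - q 0 ^ 2) ^ 2) := by ring
      rw [this, hε, one_mul]
      have h4 : (1 - q 0 ^ 2) ^ 2 ≤ 1 := by nlinarith [sq_nonneg (q 0)]
      exact mul_le_one₀ hx (sq_nonneg _) h4
    -- With `c` the height of the snake, `y (y - c) ≤ 0` and `(y - c)² ≥ 0` give `y² ≤ c² ≤ 1`.
    nlinarith [sq_nonneg (q 1 - ε * (q 0 ^ 3 - q 0))]

/-- A curve in the surface which enters an open bigon cut out by two curves can leave it only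
through the two curves. -/
theorem mem_bigon_of_forall_ne [T2Space S]
    {ψ : PartialDiffeomorph (𝓡∂ 2) 𝓘(ℝ, Plane) S Plane ∞} (hψ : ψ.target = univ)
    {a b ε : ℝ} (ha : -1 ≤ a) (hb : b ≤ 1) (ha3 : a ^ 3 = a) (hb3 : b ^ 3 = b) (hε : ε ^ 2 = 1)
    {f : ℝ → S} (hf : Continuous f) {T : ℝ}
    (hne : ∀ t ∈ Ioo 0 T, f t ∈ ψ.source → a ≤ ψ (f t) 0 → ψ (f t) 0 ≤ b →
      ψ (f t) 1 ≠ 0 ∧ ψ (f t) 1 ≠ ε * (ψ (f t) 0 ^ 3 - ψ (f t) 0))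
    {t₀ : ℝ} (ht₀ : t₀ ∈ Ioo 0 T) (hs₀ : f t₀ ∈ ψ.source) (ha₀ : a < ψ (f t₀) 0)
    (hb₀ : ψ (f t₀) 0 < b)
    (h₀ : ψ (f t₀) 1 * (ψ (f t₀) 1 - ε * (ψ (f t₀) 0 ^ 3 - ψ (f t₀) 0)) < 0)
    {t : ℝ} (ht : t ∈ Ioo 0 T) : a < ψ (f t) 0 ∧ ψ (f t) 0 < b := by
  let B : Set Plane := {q | a < q 0 ∧ q 0 < b ∧ q 1 * (q 1 - ε * (q 0 ^ 3 - q 0)) < 0}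
  let K : Set Plane := {q | a ≤ q 0 ∧ q 0 ≤ b ∧ q 1 * (q 1 - ε * (q 0 ^ 3 - q 0)) ≤ 0}
  have c : ∀ i, Continuous (fun q : Plane ↦ q i) := fun i ↦ by fun_prop
  have hBo : IsOpen B :=
    (isOpen_lt continuous_const (c 0)).inter
      ((isOpen_lt (c 0) continuous_const).inter
        (isOpen_lt ((c 1).mul ((c 1).sub (continuous_const.mul (((c 0).pow 3).sub (c 0)))))
          continuous_const))
  let V : Set S := ψ.source ∩ ψ ⁻¹' B
  have hVo : IsOpen V := ψ.contMDiffOn.continuousOn.isOpen_inter_preimage ψ.open_source hBo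
  have hKc : IsClosed (ψ.invFun '' K) := by
    refine ((isCompact_bigon ha hb hε).image_of_continuousOn ?_).isClosed
    exact ψ.contMDiffOn_invFun.continuousOn.mono (by rw [hψ]; exact subset_univ _)
  have hVK : V ⊆ ψ.invFun '' K := by
    rintro y ⟨hy, h1, h2, h3⟩
    exact ⟨ψ y, ⟨h1.le, h2.le, h3.le⟩, ψ.left_inv hy⟩
  -- Connectedness of `(0, T)`: the open bigon has an open preimage, and a limit of times in it lies
  -- in the compact bigon, hence in the open one since the sides are avoided.
  have hsub : Ioo 0 T ⊆ f ⁻¹' V := by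
    refine isPreconnected_Ioo.subset_of_closure_inter_subset (hVo.preimage hf)
      ⟨t₀, ht₀, hs₀, ha₀, hb₀, h₀⟩ ?_
    rintro s ⟨hs, hsT⟩
    have hsK : f s ∈ ψ.invFun '' K :=
      (hKc.preimage hf).closure_subset_iff.mpr (preimage_mono hVK) hs
    obtain ⟨q, ⟨h1, h2, h3⟩, hq⟩ := hsK
    have hqt : q ∈ ψ.target := hψ ▸ mem_univ q
    have hsrc : f s ∈ ψ.source := hq ▸ ψ.map_target hqt
    have hψq : ψ (f s) = q := by rw [← hq]; exact ψ.right_inv hqt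
    obtain ⟨h4, h5⟩ := hne s hsT hsrc (by rwa [hψq]) (by rwa [hψq])
    rw [hψq] at h4 h5
    have h6 : q 1 * (q 1 - ε * (q 0 ^ 3 - q 0)) < 0 :=
      lt_of_le_of_ne h3 (mul_ne_zero h4 (sub_ne_zero.mpr h5))
    -- On the vertical lines through the corners the snake has height zero, so the product in `h6`
    -- would be a square.
    have h7 : q 0 ^ 3 ≠ q 0 := by
      intro h
      rw [h] at h6
      nlinarith [sq_nonneg (q 1)]
    refine ⟨hsrc, ?_⟩
    change ψ (f s) ∈ B
    rw [hψq]
    refine ⟨lt_of_le_of_ne h1 ?_, lt_of_le_of_ne h2 ?_, h6⟩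
    · rintro rfl; exact h7 ha3
    · rintro rfl; exact h7 hb3
  exact ⟨(hsub ht).2.1, (hsub ht).2.2.1⟩

/-- A closed trajectory which passes through one corner of a bigon between its two sides, and which
meets the two sides at the same points, passes through the other corner. -/
theorem exists_apply_eq_of_bigon [T2Space S]
    {ψ : PartialDiffeomorph (𝓡∂ 2) 𝓘(ℝ, Plane) S Plane ∞} (hψ : ψ.target = univ)
    {ε : ℝ} (hε : ε ^ 2 = 1) {f : ℝ → S} (hf : Continuous f) {T : ℝ} (hT : 0 < T)
    (hper : Function.Periodic f T) (hmin : ∀ t, 0 < t → t < T → f t ≠ f 0)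
    (hiff : ∀ t, f t ∈ ψ.source →
      (ψ (f t) 1 = 0 ↔ ψ (f t) 1 = ε * (ψ (f t) 0 ^ 3 - ψ (f t) 0)))
    {Z : Plane} (hZ : HasDerivAt (fun t ↦ ψ (f t)) Z 0) (h0 : f 0 ∈ ψ.source) {x x' : ℝ}
    (hxx' : (x = -1 ∧ x' = 0) ∨ (x = 0 ∧ x' = -1) ∨ (x = 0 ∧ x' = 1) ∨ (x = 1 ∧ x' = 0))
    (hx : ψ (f 0) 0 = x) (hy : ψ (f 0) 1 = 0)
    (hZ0 : Z 0 ≠ 0) (hZ1 : Z 1 * (Z 1 - ε * (3 * x ^ 2 - 1) * Z 0) < 0) :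
    ∃ t, f t ∈ ψ.source ∧ ψ (f t) 0 = x' ∧ ψ (f t) 1 = 0 := by
  have hx3 : x ^ 3 = x := by rcases hxx' with h | h | h | h <;> rw [h.1] <;> norm_num
  have hev := eventually_between hZ hx hy hx3 hZ0 hZ1
  have hsrc : ∀ᶠ t in 𝓝 (0 : ℝ), f t ∈ ψ.source :=
    hf.continuousAt.eventually (ψ.open_source.mem_nhds h0)
  have hx0 : ContinuousAt (fun t ↦ ψ (f t) 0) 0 :=
    ((EuclideanSpace.proj (𝕜 := ℝ) (0 : Fin 2)).continuous.continuousAt).comp hZ.continuousAt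
  have hnear : ∀ᶠ t in 𝓝 (0 : ℝ), ψ (f t) 0 ∈ Ioo (x - 1) (x + 1) :=
    hx0.eventually (Ioo_mem_nhds (by simp [hx]) (by simp [hx]))
  have hsmall : ∀ᶠ t in 𝓝 (0 : ℝ), t ∈ Ioo (-T) T := Ioo_mem_nhds (by linarith) hT
  have hall := hev.and (((hsrc.and hnear).and hsmall).filter_mono nhdsWithin_le_nhds)
  -- The trajectory leaves the corner to one side of `x` just after time `0`, and arrives from the
  -- other side just before time `T`. Hence both sides are visited during `(0, T)`.
  have hside : ∀ σ : ℝ, σ ≠ 0 → ∃ t ∈ Ioo 0 T, f t ∈ ψ.source ∧ 0 < (ψ (f t) 0 - x) * σ ∧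
      ψ (f t) 0 ∈ Ioo (x - 1) (x + 1) ∧
      ψ (f t) 1 * (ψ (f t) 1 - ε * (ψ (f t) 0 ^ 3 - ψ (f t) 0)) < 0 := by
    intro σ hσ
    rcases lt_or_gt_of_ne (mul_ne_zero hσ hZ0) with hlt | hgt
    · obtain ⟨t, ⟨⟨h1, h2⟩, ⟨h3, h4⟩, h5⟩, h6⟩ :=
        ((hall.filter_mono (nhdsWithin_mono 0 (fun t (ht : t < 0) ↦ ht.ne) :
          𝓝[<] (0 : ℝ) ≤ 𝓝[≠] 0)).and self_mem_nhdsWithin).exists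
      have h6 : t < 0 := h6
      refine ⟨t + T, ⟨by linarith [h5.1], by linarith⟩, ?_⟩
      rw [hper t]
      refine ⟨h3, ?_, h4, h2⟩
      have h7 : 0 < ((ψ (f t) 0 - x) * (Z 0 * t)) * ((σ * Z 0) * t) :=
        mul_pos h1 (mul_pos_of_neg_of_neg hlt h6)
      have h8 : ((ψ (f t) 0 - x) * (Z 0 * t)) * ((σ * Z 0) * t) =
        ((ψ (f t) 0 - x) * σ) * (Z 0 * t) ^ 2 := by ring
      exact pos_of_mul_pos_left (h8 ▸ h7) (sq_nonneg _)
    · obtain ⟨t, ⟨⟨h1, h2⟩, ⟨h3, h4⟩, h5⟩, h6⟩ :=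
        ((hall.filter_mono (nhdsWithin_mono 0 (fun t (ht : 0 < t) ↦ ht.ne') :
          𝓝[>] (0 : ℝ) ≤ 𝓝[≠] 0)).and self_mem_nhdsWithin).exists
      have h6 : 0 < t := h6
      refine ⟨t, ⟨h6, h5.2⟩, h3, ?_, h4, h2⟩
      have h7 : 0 < ((ψ (f t) 0 - x) * (Z 0 * t)) * ((σ * Z 0) * t) :=
        mul_pos h1 (mul_pos hgt h6)
      have h8 : ((ψ (f t) 0 - x) * (Z 0 * t)) * ((σ * Z 0) * t) =
        ((ψ (f t) 0 - x) * σ) * (Z 0 * t) ^ 2 := by ring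
      exact pos_of_mul_pos_left (h8 ▸ h7) (sq_nonneg _)
  obtain ⟨t₁, ht₁, hs₁, hx₁, hn₁, hb₁⟩ := hside (x' - x) (by
    rcases hxx' with h | h | h | h <;> rw [h.1, h.2] <;> norm_num)
  obtain ⟨t₂, ht₂, -, hx₂, -, -⟩ := hside (x - x') (by
    rcases hxx' with h | h | h | h <;> rw [h.1, h.2] <;> norm_num)
  by_contra! hno
  have hne : ∀ t ∈ Ioo 0 T, f t ∈ ψ.source → min x x' ≤ ψ (f t) 0 → ψ (f t) 0 ≤ max x x' →
      ψ (f t) 1 ≠ 0 ∧ ψ (f t) 1 ≠ ε * (ψ (f t) 0 ^ 3 - ψ (f t) 0) := by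
    intro t ht hs hle hge
    suffices h : ψ (f t) 1 ≠ 0 from ⟨h, fun h' ↦ h ((hiff t hs).mpr h')⟩
    intro hy'
    have h3 := (hiff t hs).mp hy'
    rw [hy'] at h3
    have hε0 : ε ≠ 0 := by rintro rfl; norm_num at hε
    have h4 : ψ (f t) 0 ^ 3 - ψ (f t) 0 = 0 := by
      rcases mul_eq_zero.mp h3.symm with h | h
      · exact absurd h hε0
      · exact h
    have hxt : ψ (f t) 0 ≠ x := by
      intro h
      refine hmin t ht.1 ht.2 (ψ.injOn hs h0 ?_)
      refine PiLp.ext fun i ↦ ?_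
      fin_cases i
      · exact h.trans hx.symm
      · exact hy'.trans hy.symm
    have hxt' : ψ (f t) 0 ≠ x' := fun h ↦ hno t hs h hy'
    have h5 : ψ (f t) 0 = 0 ∨ ψ (f t) 0 = 1 ∨ ψ (f t) 0 = -1 := by
      have : ψ (f t) 0 * ((ψ (f t) 0 - 1) * (ψ (f t) 0 + 1)) = 0 := by linarith
      rcases mul_eq_zero.mp this with h | h
      · exact Or.inl h
      · rcases mul_eq_zero.mp h with h | h
        · exact Or.inr (Or.inl (by linarith))
        · exact Or.inr (Or.inr (by linarith))
    rcases hxx' with ⟨rfl, rfl⟩ | ⟨rfl, rfl⟩ | ⟨rfl, rfl⟩ | ⟨rfl, rfl⟩ <;>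
      norm_num at hle hge <;>
      rcases h5 with h5 | h5 | h5 <;> first | contradiction | linarith
  -- If `x'` is never visited, the trajectory stays over the interval between `x` and `x'` during
  -- all of `(0, T)`, although at time `t₂` it is on the other side of `x`.
  have hin := mem_bigon_of_forall_ne hψ (a := min x x') (b := max x x')
    (by rcases hxx' with h | h | h | h <;> rw [h.1, h.2] <;> norm_num)
    (by rcases hxx' with h | h | h | h <;> rw [h.1, h.2] <;> norm_num)
    (by rcases hxx' with h | h | h | h <;> rw [h.1, h.2] <;> norm_num)
    (by rcases hxx' with h | h | h | h <;> rw [h.1, h.2] <;> norm_num) hε hf hne ht₁ hs₁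
    (by rcases hxx' with ⟨rfl, rfl⟩ | ⟨rfl, rfl⟩ | ⟨rfl, rfl⟩ | ⟨rfl, rfl⟩ <;>
        norm_num at hx₁ hn₁ ⊢ <;> linarith)
    (by rcases hxx' with ⟨rfl, rfl⟩ | ⟨rfl, rfl⟩ | ⟨rfl, rfl⟩ | ⟨rfl, rfl⟩ <;>
        norm_num at hx₁ hn₁ ⊢ <;> linarith) hb₁ ht₂
  rcases hxx' with ⟨rfl, rfl⟩ | ⟨rfl, rfl⟩ | ⟨rfl, rfl⟩ | ⟨rfl, rfl⟩ <;>
    norm_num at hx₂ hin <;> linarith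

end Bigon

/-! ### Direction of the flow at a fixed crossing -/

section Corner

variable {S : Type*} [TopologicalSpace S] [ChartedSpace (EuclideanHalfSpace 2) S]
  [IsManifold (𝓡∂ 2) ∞ S]

/-- At a fixed crossing of a snake configuration, the flow points between the two curves. -/
theorem exists_hasDerivAt_between {Ω : SymplecticForm S} {H : S → ℝ} {φ : ℝ → Diffeo S}
    (h : IsHamiltonianIsotopy Ω (fun _ ↦ H) φ) {t : ℝ} {γ : ℝ → S}
    (hγ : ContMDiffOn 𝓘(ℝ, ℝ) (𝓡∂ 2) ∞ γ (Icc 0 1))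
    {ψ : PartialDiffeomorph (𝓡∂ 2) 𝓘(ℝ, Plane) S Plane ∞} {ε : ℝ} (hε : ε ^ 2 = 1)
    (hL : ∀ s ∈ Icc (0 : ℝ) 1, γ s ∈ ψ.source → ψ (γ s) 1 = 0)
    (hR : ∀ s ∈ Icc (0 : ℝ) 1, φ t (γ s) ∈ ψ.source →
      ψ (φ t (γ s)) 1 = ε * (ψ (φ t (γ s)) 0 ^ 3 - ψ (φ t (γ s)) 0))
    {s : ℝ} (hs : s ∈ Icc (0 : ℝ) 1) (hsrc : γ s ∈ ψ.source) (hfix : φ t (γ s) = γ s)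
    (hoL : 0 < derivWithin (fun s ↦ ψ (γ s) 0) (Icc 0 1) s)
    (hoR : derivWithin (fun s ↦ ψ (φ t (γ s)) 0) (Icc 0 1) s < 0)
    (h0 : initialVelocity φ (γ s) ≠ 0) :
    ∃ Z : Plane, HasDerivAt (fun r ↦ ψ (φ r (γ s))) Z 0 ∧ Z 0 ≠ 0 ∧
      Z 1 * (Z 1 - ε * (3 * ψ (γ s) 0 ^ 2 - 1) * Z 0) < 0 := by
  have hun : UniqueDiffWithinAt ℝ (Icc (0 : ℝ) 1) s := uniqueDiffOn_Icc zero_lt_one s hs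
  obtain ⟨G, hG⟩ : ∃ G : ℝ →L[ℝ] Plane, HasMFDerivWithinAt 𝓘(ℝ, ℝ) (𝓡∂ 2) γ (Icc 0 1) s G :=
    ⟨_, ((hγ s hs).mdifferentiableWithinAt (by simp)).hasMFDerivWithinAt⟩
  obtain ⟨D, hD⟩ : ∃ D : Plane →L[ℝ] Plane, HasMFDerivAt (𝓡∂ 2) (𝓡∂ 2) (φ t) (γ s) D :=
    ⟨_, ((φ t).mdifferentiable (by simp) (γ s)).hasMFDerivAt⟩
  obtain ⟨P, hP⟩ : ∃ P : Plane →L[ℝ] Plane, HasMFDerivAt (𝓡∂ 2) 𝓘(ℝ, Plane) ψ (γ s) P :=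
    ⟨_, (ψ.mdifferentiableAt (by simp) hsrc).hasMFDerivAt⟩
  have hP' : HasMFDerivAt (𝓡∂ 2) 𝓘(ℝ, Plane) ψ (φ t (γ s)) P := by rwa [hfix]
  have hP0 : HasMFDerivAt (𝓡∂ 2) 𝓘(ℝ, Plane) ψ (φ 0 (γ s)) P := by rwa [h.zero]
  have hDG : HasMFDerivWithinAt 𝓘(ℝ, ℝ) (𝓡∂ 2) (fun r ↦ φ t (γ r)) (Icc 0 1) s (D.comp G) :=
    hD.comp_hasMFDerivWithinAt s hG
  have h1 : HasMFDerivWithinAt 𝓘(ℝ, ℝ) 𝓘(ℝ, Plane) (fun r ↦ ψ (γ r)) (Icc 0 1) s (P.comp G) :=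
    hP.comp_hasMFDerivWithinAt s hG
  have h2 : HasMFDerivWithinAt 𝓘(ℝ, ℝ) 𝓘(ℝ, Plane) (fun r ↦ ψ (φ t (γ r))) (Icc 0 1) s
      (P.comp (D.comp G)) := HasMFDerivAt.comp_hasMFDerivWithinAt s hP' hDG
  let X : Plane := initialVelocity φ (γ s)
  obtain ⟨Y, hY⟩ : ∃ Y : ℝ →L[ℝ] Plane,
      HasMFDerivAt 𝓘(ℝ, ℝ) (𝓡∂ 2) (fun r ↦ φ r (γ s)) 0 Y :=
    ⟨_, (h.mdifferentiableAt_trajectory (γ s) 0).hasMFDerivAt⟩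
  have hYX : Y 1 = X := congrArg (fun B : ℝ →L[ℝ] Plane ↦ B 1) hY.mfderiv.symm
  have h3 : HasMFDerivAt 𝓘(ℝ, ℝ) 𝓘(ℝ, Plane) (fun r ↦ ψ (φ r (γ s))) 0 (P.comp Y) :=
    HasMFDerivAt.comp (0 : ℝ) hP0 hY
  have h3' : HasDerivAt (fun r ↦ ψ (φ r (γ s))) (P X) 0 := by
    have h4 : HasFDerivAt (fun r ↦ ψ (φ r (γ s))) (P.comp Y) 0 :=
      hasMFDerivAt_iff_hasFDerivAt.mp h3
    refine h4.hasDerivAt.congr_deriv ?_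
    rw [← hYX]
    rfl
  let v : Plane := G 1
  have h1' : HasDerivWithinAt (fun r ↦ ψ (γ r)) (P v) (Icc 0 1) s := by
    have h4 : HasFDerivWithinAt (fun r ↦ ψ (γ r)) (P.comp G) (Icc 0 1) s :=
      hasMFDerivWithinAt_iff_hasFDerivWithinAt.mp h1
    exact h4.hasDerivWithinAt
  have h2' : HasDerivWithinAt (fun r ↦ ψ (φ t (γ r))) (P (D v)) (Icc 0 1) s := by
    have h4 : HasFDerivWithinAt (fun r ↦ ψ (φ t (γ r))) (P.comp (D.comp G)) (Icc 0 1) s :=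
      hasMFDerivWithinAt_iff_hasFDerivWithinAt.mp h2
    exact h4.hasDerivWithinAt
  have hc1 : ∀ i, HasDerivWithinAt (fun r ↦ ψ (γ r) i) (P v i) (Icc 0 1) s := fun i ↦
    (EuclideanSpace.proj (𝕜 := ℝ) i).hasFDerivAt.comp_hasDerivWithinAt s h1'
  have hc2 : ∀ i, HasDerivWithinAt (fun r ↦ ψ (φ t (γ r)) i) (P (D v) i) (Icc 0 1) s := fun i ↦
    (EuclideanSpace.proj (𝕜 := ℝ) i).hasFDerivAt.comp_hasDerivWithinAt s h2'
  rw [(hc1 0).derivWithin hun] at hoL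
  rw [(hc2 0).derivWithin hun] at hoR
  have hev1 : ∀ᶠ r in 𝓝[Icc 0 1] s, ψ (γ r) 1 = 0 := by
    filter_upwards [hG.continuousWithinAt.eventually (ψ.open_source.mem_nhds hsrc),
      self_mem_nhdsWithin] with r hr hr'
    exact hL r hr' hr
  have hev2 : ∀ᶠ r in 𝓝[Icc 0 1] s,
      ψ (φ t (γ r)) 1 = ε * (ψ (φ t (γ r)) 0 ^ 3 - ψ (φ t (γ r)) 0) := by
    filter_upwards [hDG.continuousWithinAt.eventually
      (ψ.open_source.mem_nhds (by simpa only [hfix] using hsrc)), self_mem_nhdsWithin] with r hr hr'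
    exact hR r hr' hr
  have hv1 : P v 1 = 0 := by
    refine hun.eq_deriv _ (hc1 1) ?_
    exact (hasDerivWithinAt_const s _ (0 : ℝ)).congr_of_eventuallyEq hev1 (hL s hs hsrc)
  have hw1 : P (D v) 1 = ε * (3 * ψ (γ s) 0 ^ 2 - 1) * P (D v) 0 := by
    have h4 := ((((hc2 0).pow 3).sub (hc2 0)).const_mul ε).congr_of_eventuallyEq hev2
      (hR s hs (by rwa [hfix]))
    rw [hun.eq_deriv _ (hc2 1) h4, hfix]
    push_cast
    ring
  obtain ⟨k, hk⟩ := h.exists_mfderiv_sub_eq_smul hfix h0 hD v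
  have hk' : P (D v) - P v = k • P X := by
    rw [← map_sub, ← map_smul]
    exact congrArg P hk
  have hk0 : P (D v) 0 - P v 0 = k * P X 0 := congrArg (fun q : Plane ↦ q 0) hk'
  have hk1 : P (D v) 1 - P v 1 = k * P X 1 := congrArg (fun q : Plane ↦ q 1) hk'
  have hy := hL s hs hsrc
  have hy' := hR s hs (by rwa [hfix])
  rw [hfix, hy] at hy'
  refine ⟨P X, h3', ?_, ?_⟩
  · intro hz
    rw [hz, mul_zero] at hk0
    linarith
  · generalize ψ (γ s) 0 = x at *
    generalize P (D v) 0 = b at *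
    generalize P v 0 = a at *
    generalize P X 0 = z at *
    generalize P X 1 = y at *
    rw [hv1, sub_zero, hw1] at hk1
    -- The snake has nonzero slope at its zeros: `x³ - x` has no double root.
    have hm : (ε * (3 * x ^ 2 - 1)) ≠ 0 := by
      intro h4
      have hε0 : ε ≠ 0 := by rintro rfl; norm_num at hε
      have h5 : 3 * x ^ 2 - 1 = 0 := (mul_eq_zero.mp h4).resolve_left hε0
      have h6 : x ^ 3 - x = 0 := (mul_eq_zero.mp hy'.symm).resolve_left hε0
      have h7 : x = 0 := by linear_combination (x / 2) * h5 - (3 / 2) * h6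
      rw [h7] at h5
      norm_num at h5
    generalize ε * (3 * x ^ 2 - 1) = m at *
    -- In coordinates `v = (a, 0)`, `D v = (b, m b)` and `X = (z, y)`, so `k z = b - a` and `k y = m
    -- b`. The sign then comes from the opposite orientations `a > 0 > b`.
    have h4 : k ^ 2 * (y * (y - m * z)) = m ^ 2 * (a * b) := by
      have h6 : k ^ 2 * (y * (y - m * z)) = (k * y) * (k * y - m * (k * z)) := by ring
      rw [h6, ← hk1, ← hk0]
      ring
    have h5 : m ^ 2 * (a * b) < 0 :=
      mul_neg_of_pos_of_neg (by positivity) (mul_neg_of_pos_of_neg hoL hoR)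
    rw [← h4] at h5
    exact neg_of_mul_neg_right h5 (sq_nonneg k)

end Corner

/-! ### Order of points along arcs and closed curves -/

theorem exists_int_of_apply_eq {S : Type*} {η : ℝ → S} (hper : Function.Periodic η 1)
    (hinj : InjOn η (Ico 0 1)) {s t : ℝ} (h : η s = η t) : ∃ n : ℤ, s = t + n := by
  have hfr : ∀ r, η (Int.fract r) = η r := fun r ↦ by
    have := hper.sub_int_mul_eq (x := r) ⌊r⌋
    rwa [mul_one] at this
  have := hinj ⟨Int.fract_nonneg s, Int.fract_lt_one s⟩ ⟨Int.fract_nonneg t, Int.fract_lt_one t⟩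
    ((hfr s).trans (h.trans (hfr t).symm))
  refine ⟨⌊s⌋ - ⌊t⌋, ?_⟩
  rw [Int.fract, Int.fract] at this
  push_cast
  linarith

section Order

variable {S : Type*} [TopologicalSpace S] [T2Space S]

/-- Two parametrizations `η` and `e` of an arc have the same orientation as soon as the
coordinate `F` that inverts `e` increases along `η` at one point. -/
theorem strictMonoOn_reparametrization {η e : ℝ → S} {a b : ℝ} (hη : ContinuousOn η (Icc a b))
    (he : Continuous e) {σ F : ℝ → ℝ} (hσ : ∀ x ∈ Icc (-1 : ℝ) 1, σ x ∈ Icc a b)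
    (hση : ∀ x ∈ Icc (-1 : ℝ) 1, η (σ x) = e x)
    (huniq : ∀ x ∈ Icc (-1 : ℝ) 1, ∀ t ∈ Icc a b, η t = e x → t = σ x)
    (hF : ∀ x ∈ Icc (-1 : ℝ) 1, F (σ x) = x) (hd : σ 0 ∈ Ioo a b → 0 < deriv F (σ 0)) :
    StrictMonoOn σ (Icc (-1) 1) := by
  -- `σ` inverts `η` along `e`, and `η` maps closed subsets of the compact interval to closed sets,
  -- so preimages of closed sets under `σ` are closed.
  have hcont : ContinuousOn σ (Icc (-1) 1) := by
    rw [continuousOn_iff_isClosed]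
    intro C hC
    refine ⟨e ⁻¹' (η '' (C ∩ Icc a b)), ?_, ?_⟩
    · exact (((isCompact_Icc.inter_left hC).image_of_continuousOn
        (hη.mono inter_subset_right)).isClosed).preimage he
    · ext x
      constructor
      · rintro ⟨hx, hx1⟩
        exact ⟨⟨σ x, ⟨hx, hσ x hx1⟩, hση x hx1⟩, hx1⟩
      · rintro ⟨⟨t, ⟨htC, ht⟩, hte⟩, hx1⟩
        refine ⟨?_, hx1⟩
        change σ x ∈ C
        rwa [← huniq x hx1 t ht hte]
  have hinj : InjOn σ (Icc (-1) 1) := fun x hx y hy hxy ↦ by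
    rw [← hF x hx, ← hF y hy, hxy]
  rcases hcont.strictMonoOn_of_injOn_Icc' (by norm_num) hinj with hmono | hanti
  · exact hmono
  -- If `σ` were decreasing, `σ 0` would be interior to `[a, b]`, so `hd` applies there. But `F ∘ σ
  -- = id` makes the slopes of `F` along `σ` nonpositive.
  exfalso
  have m0 : (0 : ℝ) ∈ Icc (-1 : ℝ) 1 := by norm_num
  have m1 : (1 : ℝ) ∈ Icc (-1 : ℝ) 1 := by norm_num
  have m2 : (-1 : ℝ) ∈ Icc (-1 : ℝ) 1 := by norm_num
  have h01 : σ 1 < σ 0 := hanti m0 m1 (by norm_num)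
  have h02 : σ 0 < σ (-1) := hanti m2 m0 (by norm_num)
  have hpos := hd ⟨(hσ 1 m1).1.trans_lt h01, h02.trans_le (hσ (-1) m2).2⟩
  have hdF : HasDerivAt F (deriv F (σ 0)) (σ 0) :=
    (differentiableAt_of_deriv_ne_zero hpos.ne').hasDerivAt
  have hslope : ∀ᶠ s in 𝓝[≠] (σ 0), 0 < slope F (σ 0) s :=
    (hasDerivAt_iff_tendsto_slope.mp hdF).eventually (lt_mem_nhds hpos)
  have htend : Filter.Tendsto σ (𝓝[>] 0) (𝓝[≠] (σ 0)) := by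
    refine tendsto_nhdsWithin_iff.mpr ⟨?_, ?_⟩
    · exact (hcont.continuousAt (Icc_mem_nhds (by norm_num) (by norm_num))).tendsto.mono_left
        nhdsWithin_le_nhds
    · filter_upwards [Ioo_mem_nhdsGT (zero_lt_one' ℝ)] with x hx
      exact (hanti m0 ⟨by linarith [hx.1], hx.2.le⟩ hx.1).ne
  obtain ⟨x, hx, hx1⟩ := ((htend.eventually hslope).and (Ioo_mem_nhdsGT (zero_lt_one' ℝ))).exists
  have hxm : x ∈ Icc (-1 : ℝ) 1 := ⟨by linarith [hx1.1], hx1.2.le⟩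
  have hlt : σ x < σ 0 := hanti m0 hxm hx1.1
  rw [slope_def_field, hF x hxm, hF 0 m0, sub_zero] at hx
  exact absurd hx (not_lt.mpr (div_nonpos_of_nonneg_of_nonpos hx1.1.le (by linarith)))

theorem exists_lt_lt_of_arc {η e : ℝ → S} (hη : ContinuousOn η (Icc 0 1))
    (hinj : InjOn η (Icc 0 1)) (he : Continuous e)
    (hmem : ∀ x ∈ Icc (-1 : ℝ) 1, e x ∈ η '' Icc 0 1) {F : ℝ → ℝ}
    (hF : ∀ x ∈ Icc (-1 : ℝ) 1, ∀ t ∈ Icc (0 : ℝ) 1, η t = e x → F t = x)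
    (hd : ∀ t ∈ Icc (0 : ℝ) 1, η t = e 0 → 0 < derivWithin F (Icc 0 1) t) :
    ∃ r ∈ Icc (0 : ℝ) 1, ∃ s ∈ Icc (0 : ℝ) 1, ∃ t ∈ Icc (0 : ℝ) 1,
      r < s ∧ s < t ∧ η r = e (-1) ∧ η s = e 0 ∧ η t = e 1 := by
  choose! σ hσ hση using hmem
  have m0 : (0 : ℝ) ∈ Icc (-1 : ℝ) 1 := by norm_num
  have m1 : (1 : ℝ) ∈ Icc (-1 : ℝ) 1 := by norm_num
  have m2 : (-1 : ℝ) ∈ Icc (-1 : ℝ) 1 := by norm_num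
  have hmono := strictMonoOn_reparametrization hη he hσ hση
    (fun x hx t ht hte ↦ hinj ht (hσ x hx) (hte.trans (hση x hx).symm))
    (fun x hx ↦ hF x hx _ (hσ x hx) (hση x hx)) (fun h0 ↦ by
      rw [← derivWithin_of_mem_nhds (Icc_mem_nhds h0.1 h0.2)]
      exact hd _ (hσ 0 m0) (hση 0 m0))
  exact ⟨σ (-1), hσ _ m2, σ 0, hσ _ m0, σ 1, hσ _ m1, hmono m2 m0 (by norm_num),
    hmono m0 m1 (by norm_num), hση _ m2, hση _ m0, hση _ m1⟩

theorem exists_lt_lt_of_closed {η e : ℝ → S} (hη : Continuous η) (hper : Function.Periodic η 1)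
    (hinj : InjOn η (Ico 0 1)) (he : Continuous e)
    (hmem : ∀ x, e x ∈ range η) {F : ℝ → ℝ} (hF : ∀ x t, η t = e x → F t = x)
    (hd : ∀ t, η t = e 0 → 0 < deriv F t) :
    ∃ r s t : ℝ, r < s ∧ s < t ∧ t < r + 1 ∧ η r = e (-1) ∧ η s = e 0 ∧ η t = e 1 := by
  -- The circle is cut open at the point `e 2`, which lies off the segment `e '' [-1, 1]`; the lifts
  -- of that segment then stay inside the open fundamental interval.
  obtain ⟨c, hc⟩ := hmem 2
  have hc' : η (c + 1) = e 2 := (hper c).trans hc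
  have hlift : ∀ x ∈ Icc (-1 : ℝ) 1, ∃ t ∈ Icc c (c + 1), η t = e x := by
    intro x _
    obtain ⟨t, ht⟩ := hmem x
    obtain ⟨y, hy, hyt⟩ := hper.exists_mem_Ico zero_lt_one t c
    exact ⟨y, Ico_subset_Icc_self hy, hyt.symm.trans ht⟩
  choose! σ hσ hση using hlift
  have hIoo : ∀ x ∈ Icc (-1 : ℝ) 1, ∀ t ∈ Icc c (c + 1), η t = e x → t ∈ Ioo c (c + 1) := by
    intro x hx t ht hte
    refine ⟨lt_of_le_of_ne ht.1 ?_, lt_of_le_of_ne ht.2 ?_⟩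
    · rintro rfl
      linarith [hF x _ hte, hF 2 _ hc, hx.2]
    · rintro rfl
      linarith [hF x _ hte, hF 2 _ hc', hx.2]
  have m0 : (0 : ℝ) ∈ Icc (-1 : ℝ) 1 := by norm_num
  have m1 : (1 : ℝ) ∈ Icc (-1 : ℝ) 1 := by norm_num
  have m2 : (-1 : ℝ) ∈ Icc (-1 : ℝ) 1 := by norm_num
  have hmono := strictMonoOn_reparametrization hη.continuousOn he hσ hση
    (fun x hx t ht hte ↦ by
      have h1 := hIoo x hx t ht hte
      have h2 := hIoo x hx (σ x) (hσ x hx) (hση x hx)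
      obtain ⟨n, hn⟩ := exists_int_of_apply_eq hper hinj (hte.trans (hση x hx).symm)
      have h3 : (n : ℝ) < 1 := by linarith [h1.2, h2.1]
      have h4 : (-1 : ℝ) < n := by linarith [h1.1, h2.2]
      have h5 : n < 1 := by exact_mod_cast h3
      have h6 : -1 < n := by exact_mod_cast h4
      have h7 : n = 0 := by omega
      rw [hn, h7]
      simp)
    (fun x hx ↦ hF x _ (hση x hx)) (fun _ ↦ hd _ (hση 0 m0))
  refine ⟨σ (-1), σ 0, σ 1, hmono m2 m0 (by norm_num), hmono m0 m1 (by norm_num), ?_,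
    hση _ m2, hση _ m0, hση _ m1⟩
  linarith [(hIoo 1 m1 _ (hσ 1 m1) (hση 1 m1)).2, (hσ (-1) m2).1]

/-- Three points on a circle cannot be traversed in both cyclic orders. -/
theorem false_of_cyclic_orders {r s t r' s' t' : ℝ} {k m n : ℤ} (h1 : r < s) (h2 : s < t)
    (h3 : t < r + 1) (h1' : t' < s') (h2' : s' < r') (h3' : r' < t' + 1)
    (hr : r' = r + k) (hs : s' = s + m) (ht : t' = t + n) : False := by
  have h4 : (n : ℝ) < m := by linarith
  have h5 : (m : ℝ) < k := by linarith
  have h6 : n < m := by exact_mod_cast h4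
  have h7 : m < k := by exact_mod_cast h5
  -- Reversed order forces the integer shifts to satisfy `n < m < k`, while `h3` and `h3'` together
  -- give `k < n + 2`.
  have h8 : (n : ℝ) + 2 ≤ k := by exact_mod_cast (by omega : n + 2 ≤ k)
  linarith

end Order

/-! ### The snake reverses the order of its crossings -/

/-- Orientation is prescribed by derivatives within `[0, 1]`, while the cyclic order is read on an
arbitrary fundamental interval; periodicity links the two. -/
theorem deriv_eq_derivWithin_fract {F : ℝ → ℝ} (hF : Function.Periodic F 1) {t : ℝ}
    (hd : DifferentiableAt ℝ F (Int.fract t)) :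
    deriv F t = derivWithin F (Icc 0 1) (Int.fract t) := by
  rw [hd.derivWithin (uniqueDiffOn_Icc zero_lt_one _
    ⟨Int.fract_nonneg t, (Int.fract_lt_one t).le⟩)]
  have h1 : (fun s ↦ F (s + (⌊t⌋ : ℝ))) = F := funext fun s ↦ by
    have := hF.int_mul ⌊t⌋ s
    rwa [mul_one] at this
  have h2 := deriv_comp_add_const F (⌊t⌋ : ℝ) (Int.fract t)
  rw [h1, Int.fract_add_floor] at h2
  exact h2.symm

section Snake

variable {S : Type*} [TopologicalSpace S] [ChartedSpace (EuclideanHalfSpace 2) S]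

theorem mem_iff_of_image_inter_source_eq
    {ψ : PartialDiffeomorph (𝓡∂ 2) 𝓘(ℝ, Plane) S Plane ∞} {A : Set S} {B : Set Plane}
    (h : ψ '' (A ∩ ψ.source) = B) {x : S} (hx : x ∈ ψ.source) : x ∈ A ↔ ψ x ∈ B := by
  constructor
  · exact fun hA ↦ h ▸ mem_image_of_mem ψ ⟨hA, hx⟩
  · intro hB
    rw [← h] at hB
    obtain ⟨y, ⟨hyA, hys⟩, hyx⟩ := hB
    rwa [← ψ.injOn hys hx hyx]

theorem IsAdmissibleCurve.contMDiffOn {γ : ℝ → S} (hγ : IsAdmissibleCurve γ) :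
    ContMDiffOn 𝓘(ℝ, ℝ) (𝓡∂ 2) ∞ γ (Icc 0 1) :=
  hγ.elim (fun h ↦ h.smooth.contMDiffOn) (fun h ↦ h.smooth)

theorem differentiableAt_coord {ψ : PartialDiffeomorph (𝓡∂ 2) 𝓘(ℝ, Plane) S Plane ∞} {η : ℝ → S}
    (hη : ContMDiff 𝓘(ℝ, ℝ) (𝓡∂ 2) ∞ η) {t : ℝ} (ht : η t ∈ ψ.source) (i : Fin 2) :
    DifferentiableAt ℝ (fun s ↦ ψ (η s) i) t := by
  have h1 : MDifferentiableAt 𝓘(ℝ, ℝ) 𝓘(ℝ, Plane) (fun s ↦ ψ (η s)) t :=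
    (ψ.mdifferentiableAt (by simp) ht).comp t (hη.mdifferentiableAt (by simp))
  exact (EuclideanSpace.proj (𝕜 := ℝ) i).differentiableAt.comp t
    (mdifferentiableAt_iff_differentiableAt.mp h1)

theorem continuous_invFun_graph {ψ : PartialDiffeomorph (𝓡∂ 2) 𝓘(ℝ, Plane) S Plane ∞}
    (hψ : ψ.target = univ) {u v : ℝ → ℝ} (hu : Continuous u) (hv : Continuous v) :
    Continuous (fun x ↦ ψ.invFun !₂[u x, v x]) := by
  have h1 : Continuous ψ.invFun := by
    rw [← continuousOn_univ, ← hψ]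
    exact ψ.contMDiffOn_invFun.continuousOn
  refine h1.comp ((PiLp.continuous_toLp 2 _).comp (continuous_pi fun i ↦ ?_))
  fin_cases i
  · exact hu
  · exact hv

/-- If `g` fixes the three crossings of a snake configuration of `γ` and `g ∘ γ`, their order along
`γ` is both preserved and reversed, which is absurd. -/
theorem IsSnake.exists_apply_ne [T2Space S] {γ : ℝ → S} (hγ : IsAdmissibleCurve γ) {g : Diffeo S}
    {ψ : PartialDiffeomorph (𝓡∂ 2) 𝓘(ℝ, Plane) S Plane ∞} (hs : IsSnake γ (g ∘ γ) ψ) :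
    ∃ x : ℝ, (x = -1 ∨ x = 0 ∨ x = 1) ∧ g (ψ.invFun !₂[x, 0]) ≠ ψ.invFun !₂[x, 0] := by
  by_contra! hfix
  obtain ⟨ε, hε, hR⟩ := hs.image_right
  have hsrc : ∀ q : Plane, ψ.invFun q ∈ ψ.source := fun q ↦
    ψ.map_target (hs.target_eq ▸ mem_univ q)
  have hinv : ∀ q : Plane, ψ (ψ.invFun q) = q := fun q ↦
    ψ.right_inv (hs.target_eq ▸ mem_univ q)
  let e : ℝ → S := fun x ↦ ψ.invFun !₂[x, 0]
  -- The snake is parametrized from right to left, so that the coordinate `-ψ 0` inverts `d` and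
  -- increases along `g ∘ γ`. Its crossings at parameters `-1, 0, 1` are `e 1, e 0, e (-1)`.
  let d : ℝ → S := fun x ↦ ψ.invFun !₂[-x, ε * ((-x) ^ 3 - -x)]
  have hec : Continuous e := continuous_invFun_graph hs.target_eq continuous_id continuous_const
  have hdc : Continuous d := continuous_invFun_graph hs.target_eq (by fun_prop) (by fun_prop)
  have hemem : ∀ x, e x ∈ curveTrace γ := fun x ↦ by
    refine (mem_iff_of_image_inter_source_eq hs.image_left (hsrc _)).mpr ?_
    change ψ (ψ.invFun !₂[x, 0]) 1 = 0
    rw [hinv]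
    rfl
  have hdmem : ∀ x, d x ∈ curveTrace (g ∘ γ) := fun x ↦ by
    refine (mem_iff_of_image_inter_source_eq hR (hsrc _)).mpr ?_
    rw [hinv]
    rfl
  have heF : ∀ x t, γ t = e x → ψ (γ t) 0 = x := fun x t h ↦ by
    rw [h]
    change ψ (ψ.invFun !₂[x, 0]) 0 = x
    rw [hinv]
    rfl
  have hdF : ∀ x t, (g ∘ γ) t = d x → -ψ (g (γ t)) 0 = x := fun x t h ↦ by
    have h' : g (γ t) = d x := h
    rw [h']
    change -ψ (ψ.invFun !₂[-x, ε * ((-x) ^ 3 - -x)]) 0 = x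
    rw [hinv]
    exact neg_neg x
  have hd0 : d 0 = e 0 := by simp [d, e]
  have hd1 : d 1 = e (-1) := by simp [d, e]; norm_num
  have hd2 : d (-1) = e 1 := by simp [d, e]
  -- Since `g` fixes the crossings, the parameters at which `g ∘ γ` meets them are parameters at
  -- which `γ` does.
  have hback : ∀ x t, (x = -1 ∨ x = 0 ∨ x = 1) → (g ∘ γ) t = e x → γ t = e x := fun x t hx h ↦
    g.injective (h.trans (hfix x hx).symm)
  have hesrc : ∀ x, e x ∈ ψ.source := fun x ↦ hsrc _
  have hdsrc : ∀ x, d x ∈ ψ.source := fun x ↦ hsrc _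
  rcases hγ with hγ | hγ
  · have hfr : ∀ r, γ (Int.fract r) = γ r := fun r ↦ by
      have := hγ.periodic.sub_int_mul_eq (x := r) ⌊r⌋
      rwa [mul_one] at this
    have hfm : ∀ r, Int.fract r ∈ Icc (0 : ℝ) 1 := fun r ↦
      ⟨Int.fract_nonneg r, (Int.fract_lt_one r).le⟩
    have hgs : ContMDiff 𝓘(ℝ, ℝ) (𝓡∂ 2) ∞ (g ∘ γ) := g.contMDiff.comp hγ.smooth
    obtain ⟨r, s, t, h1, h2, h3, hr, hs', ht⟩ := exists_lt_lt_of_closed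
      (F := fun t ↦ ψ (γ t) 0) hγ.smooth.continuous hγ.periodic hγ.injOn hec
      (fun x ↦ (image_subset_range _ _) (hemem x)) heF (fun t ht ↦ by
        have hsr : γ (Int.fract t) ∈ ψ.source := by rw [hfr, ht]; exact hesrc 0
        rw [deriv_eq_derivWithin_fract (fun x ↦ by rw [hγ.periodic x])
          (differentiableAt_coord hγ.smooth hsr 0)]
        exact hs.orient_left _ (hfm t) hsr)
    obtain ⟨t', s', r', h1', h2', h3', ht', hs'', hr'⟩ := exists_lt_lt_of_closed
      (η := g ∘ γ) (F := fun t ↦ -ψ (g (γ t)) 0) hgs.continuous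
      (fun x ↦ congrArg g (hγ.periodic x)) (g.injective.comp_injOn hγ.injOn) hdc
      (fun x ↦ (image_subset_range _ _) (hdmem x)) hdF (fun t ht ↦ by
        have hsr : (g ∘ γ) (Int.fract t) ∈ ψ.source := by
          have h4 : (g ∘ γ) (Int.fract t) = d 0 := (congrArg g (hfr t)).trans ht
          rw [h4]
          exact hdsrc 0
        rw [deriv_eq_derivWithin_fract (F := fun t ↦ -ψ (g (γ t)) 0)
          (fun x ↦ by simp only [hγ.periodic x]) (differentiableAt_coord hgs hsr 0).fun_neg, derivWithin.fun_neg]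
        exact neg_pos.mpr (hs.orient_right _ (hfm t) hsr))
    obtain ⟨k, hk⟩ := exists_int_of_apply_eq hγ.periodic hγ.injOn
      ((hback (-1) r' (by simp) (hr'.trans hd1)).trans hr.symm)
    obtain ⟨m, hm⟩ := exists_int_of_apply_eq hγ.periodic hγ.injOn
      ((hback 0 s' (by simp) (hs''.trans hd0)).trans hs'.symm)
    obtain ⟨n, hn⟩ := exists_int_of_apply_eq hγ.periodic hγ.injOn
      ((hback 1 t' (by simp) (ht'.trans hd2)).trans ht.symm)
    exact false_of_cyclic_orders h1 h2 h3 h1' h2' h3' hk hm hn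
  · obtain ⟨r, hrm, s, hsm, t, htm, h1, h2, hr, hs', ht⟩ := exists_lt_lt_of_arc
      (F := fun t ↦ ψ (γ t) 0) hγ.smooth.continuousOn hγ.injOn hec (fun x _ ↦ hemem x)
      (fun x _ t _ ↦ heF x t) (fun t ht hte ↦ hs.orient_left t ht (hte ▸ hesrc 0))
    obtain ⟨t', htm', s', hsm', r', hrm', h1', h2', ht', hs'', hr'⟩ := exists_lt_lt_of_arc
      (η := g ∘ γ) (F := fun t ↦ -ψ (g (γ t)) 0)
      (g.continuous.comp_continuousOn hγ.smooth.continuousOn)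
      (g.injective.comp_injOn hγ.injOn) hdc (fun x _ ↦ hdmem x)
      (fun x _ t _ ↦ hdF x t) (fun t ht hte ↦ by
        rw [derivWithin.fun_neg]
        exact neg_pos.mpr (hs.orient_right t ht (hte ▸ hdsrc 0)))
    have hk := hγ.injOn hrm' hrm ((hback (-1) r' (by simp) (hr'.trans hd1)).trans hr.symm)
    have hm := hγ.injOn hsm' hsm ((hback 0 s' (by simp) (hs''.trans hd0)).trans hs'.symm)
    linarith

end Snake

/-! ### Propagation of the loop through the crossings, and the theorem -/

section Loop

variable {S : Type*} [TopologicalSpace S] [T2Space S] [ChartedSpace (EuclideanHalfSpace 2) S]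
  [IsManifold (𝓡∂ 2) ∞ S]

/-- A loop of fixed points through one crossing of a snake configuration runs through the
neighbouring crossings. -/
theorem exists_mem_loop_neighbour {Ω : SymplecticForm S} {H : S → ℝ} {φ : ℝ → Diffeo S}
    (h : IsHamiltonianIsotopy Ω (fun _ ↦ H) φ) {γ : ℝ → S} (hγ : IsAdmissibleCurve γ)
    {ψ : PartialDiffeomorph (𝓡∂ 2) 𝓘(ℝ, Plane) S Plane ∞} (hs : IsSnake γ (φ 1 ∘ γ) ψ)
    {x₀ : S} (hint : (𝓡∂ 2).IsInteriorPoint x₀) {T : ℝ} (hT : 0 < T) (hper : φ T x₀ = x₀)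
    (hmin : ∀ s, 0 < s → s < T → φ s x₀ ≠ x₀) (hfix : ∀ t, φ 1 (φ t x₀) = φ t x₀)
    {x x' : ℝ}
    (hxx' : (x = -1 ∧ x' = 0) ∨ (x = 0 ∧ x' = -1) ∨ (x = 0 ∧ x' = 1) ∨ (x = 1 ∧ x' = 0))
    (hx : ∃ t, φ t x₀ ∈ ψ.source ∧ ψ (φ t x₀) 0 = x ∧ ψ (φ t x₀) 1 = 0) :
    ∃ t, φ t x₀ ∈ ψ.source ∧ ψ (φ t x₀) 0 = x' ∧ ψ (φ t x₀) 1 = 0 := by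
  obtain ⟨t, hsrc, hx0, hx1⟩ := hx
  obtain ⟨ε, hε, hR⟩ := hs.image_right
  have hε2 : ε ^ 2 = 1 := by rcases hε with rfl | rfl <;> norm_num
  obtain ⟨s, hsI, hst⟩ : φ t x₀ ∈ curveTrace γ :=
    (mem_iff_of_image_inter_source_eq hs.image_left hsrc).mpr hx1
  have hflow : ∀ r, φ r (γ s) = φ (r + t) x₀ := fun r ↦ by rw [hst, h.apply_apply hint]
  rw [← hst] at hsrc hx0 hx1
  have hfixs : φ 1 (γ s) = γ s := by rw [hst, hfix]
  have hperA : ∀ r, φ (r + T) (γ s) = φ r (γ s) := fun r ↦ by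
    rw [hflow, hflow, add_right_comm, ← h.apply_apply hint, hper]
  have hminA : ∀ r, 0 < r → r < T → φ r (γ s) ≠ γ s := fun r hr hrT heq ↦ by
    refine hmin r hr hrT ((φ t).injective ?_)
    change φ t (φ r x₀) = φ t x₀
    rw [h.apply_apply hint, add_comm, ← hflow, heq, hst]
  -- A zero of the field would make the trajectory constant, against the minimality of `T` at time
  -- `T / 2`.
  have h0 : initialVelocity φ (γ s) ≠ 0 := fun hz ↦ by
    refine hminA (T / 2) (by linarith) (by linarith)
      (h.apply_eq_of_initialVelocity_eq_zero ?_ hz _)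
    rw [hst]
    exact (isInteriorPoint_apply_iff _ _).mpr hint
  obtain ⟨Z, hZ, hZ0, hZ1⟩ := exists_hasDerivAt_between h hγ.contMDiffOn hε2
    (fun r hr hr' ↦ (mem_iff_of_image_inter_source_eq hs.image_left hr').mp ⟨r, hr, rfl⟩)
    (fun r hr hr' ↦ (mem_iff_of_image_inter_source_eq hR hr').mp ⟨r, hr, rfl⟩)
    hsI hsrc hfixs (hs.orient_left s hsI hsrc)
    (hs.orient_right s hsI (by rwa [Function.comp_apply, hfixs])) h0
  have hz : φ 0 (γ s) = γ s := h.zero _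
  obtain ⟨r, hr, hr0, hr1⟩ := exists_apply_eq_of_bigon hs.target_eq hε2
    (h.continuous_trajectory (γ s)) hT hperA (fun r h1 h2 ↦ by rw [hz]; exact hminA r h1 h2)
    -- Both `g` and its inverse fix the points of the loop, so lying on `L` and lying on `g(L)` are
    -- equivalent for them.
    (fun r hr ↦ by
      refine (mem_iff_of_image_inter_source_eq hs.image_left hr).symm.trans
        (Iff.trans ?_ (mem_iff_of_image_inter_source_eq hR hr))
      have hfr : φ 1 (φ r (γ s)) = φ r (γ s) := by rw [hflow, hfix]
      constructor
      · rintro ⟨a, ha, hae⟩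
        exact ⟨a, ha, (congrArg (φ 1) hae).trans hfr⟩
      · rintro ⟨a, ha, hae⟩
        exact ⟨a, ha, (φ 1).injective (hae.trans hfr.symm)⟩)
    hZ (by rwa [hz]) hxx' (by rw [hz, hx0]) (by rw [hz, hx1]) hZ0 (by rwa [hx0] at hZ1)
  exact ⟨r + t, by rw [← hflow]; exact ⟨hr, hr0, hr1⟩⟩

end Loop

end CurveObstruction

theorem theorem1 {S : Type*} [TopologicalSpace S] [T2Space S] [CompactSpace S]
    [ChartedSpace (EuclideanHalfSpace 2) S] [IsManifold (𝓡∂ 2) ∞ S]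
    (Ω : SymplecticForm S)
    (γ : ℝ → S) (hγ : IsAdmissibleCurve γ)
    (N : Set S) (hN : (𝓡∂ 2).boundary S ⊆ N)
    (M : Set (Diffeo S)) (hM : M ⊆ Ham Ω)
    (hF : HasFixedLoopProperty Ω M (curveTrace γ \ N))
    (g : Diffeo S) (hg : g ∈ M)
    (htrans : ∀ p ∈ (curveTrace γ ∩ g '' curveTrace γ) \ N, TransverseAt γ (g ∘ γ) p)
    (hsnake : ∀ p ∈ (curveTrace γ ∩ g '' curveTrace γ) \ N, TransverseAt γ (g ∘ γ) p →
      ∃ ψ : PartialDiffeomorph (𝓡∂ 2) 𝓘(ℝ, Plane) S Plane ∞,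
        p ∈ ψ.source ∧ IsSnake γ (g ∘ γ) ψ) :
    ¬ IsAutonomous Ω g := by
  intro hA
  obtain ⟨φ, ⟨H, h⟩, rfl, c, ⟨x₀, T, hT, hper, hmin, rfl, n, hn⟩, p, ⟨t₀, rfl⟩, hpL, hpN⟩ :=
    hF g hg hA
  -- The loop has a point outside `N ⊇ ∂S`, and the flow preserves the interior.
  have hint : (𝓡∂ 2).IsInteriorPoint x₀ := by
    rw [← isInteriorPoint_apply_iff (φ t₀),
      ModelWithCorners.isInteriorPoint_iff_not_isBoundaryPoint]
    exact fun hb ↦ hpN (hN hb)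
  have hperiodic : Function.Periodic (fun t ↦ φ t x₀) T := fun t ↦ by
    change φ (t + T) x₀ = φ t x₀
    rw [← h.apply_apply hint, hper]
  have hfix : ∀ t, φ 1 (φ t x₀) = φ t x₀ := fun t ↦ by
    have h1 : (n : ℝ) * T = 1 := by rw [← hn]; field_simp
    have h2 : φ (t + n * T) x₀ = φ t x₀ := hperiodic.nat_mul n t
    rw [h.apply_apply hint, add_comm, ← h1, h2]
  have hp : φ t₀ x₀ ∈ (curveTrace γ ∩ φ 1 '' curveTrace γ) \ N :=
    ⟨⟨hpL, _, hpL, hfix t₀⟩, hpN⟩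
  obtain ⟨ψ, hsrc, hs⟩ := hsnake _ hp (htrans _ hp)
  obtain ⟨ε, hε, hR⟩ := hs.image_right
  have hy : ψ (φ t₀ x₀) 1 = 0 := (mem_iff_of_image_inter_source_eq hs.image_left hsrc).mp hpL
  have hw : ψ (φ t₀ x₀) 1 = ε * (ψ (φ t₀ x₀) 0 ^ 3 - ψ (φ t₀ x₀) 0) :=
    (mem_iff_of_image_inter_source_eq hR hsrc).mp (by
      rw [curveTrace, image_comp]
      exact hp.1.2)
  have hx : ψ (φ t₀ x₀) 0 = 0 ∨ ψ (φ t₀ x₀) 0 = 1 ∨ ψ (φ t₀ x₀) 0 = -1 := by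
    have h1 : ψ (φ t₀ x₀) 0 * ((ψ (φ t₀ x₀) 0 - 1) * (ψ (φ t₀ x₀) 0 + 1)) = 0 := by
      rcases hε with rfl | rfl <;> linarith
    rcases mul_eq_zero.mp h1 with h1 | h1
    · exact Or.inl h1
    · rcases mul_eq_zero.mp h1 with h1 | h1
      · exact Or.inr (Or.inl (by linarith))
      · exact Or.inr (Or.inr (by linarith))
  -- Only neighbouring crossings bound a common bigon, so the passage between `-1` and `1` goes
  -- through `0`.
  have hstep := fun x x' hxx' ↦
    exists_mem_loop_neighbour (x := x) (x' := x') h hγ hs hint hT hper hmin hfix hxx'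
  have hzero : ∃ t, φ t x₀ ∈ ψ.source ∧ ψ (φ t x₀) 0 = 0 ∧ ψ (φ t x₀) 1 = 0 := by
    rcases hx with hx | hx | hx
    · exact ⟨t₀, hsrc, hx, hy⟩
    · exact hstep 1 0 (by simp) ⟨t₀, hsrc, hx, hy⟩
    · exact hstep (-1) 0 (by simp) ⟨t₀, hsrc, hx, hy⟩
  obtain ⟨x, hx, hne⟩ := hs.exists_apply_ne hγ
  obtain ⟨t, hts, ht0, ht1⟩ :
      ∃ t, φ t x₀ ∈ ψ.source ∧ ψ (φ t x₀) 0 = x ∧ ψ (φ t x₀) 1 = 0 := by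
    rcases hx with rfl | rfl | rfl
    · exact hstep 0 (-1) (by simp) hzero
    · exact hzero
    · exact hstep 0 1 (by simp) hzero
  have hpt : ψ.invFun !₂[x, 0] = φ t x₀ := by
    have h1 : ψ (φ t x₀) = !₂[x, 0] := by
      refine PiLp.ext fun i ↦ ?_
      fin_cases i
      · exact ht0
      · exact ht1
    rw [← h1]
    exact ψ.left_inv hts
  exact hne (by rw [hpt, hfix])
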